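/- Let $\mathcal X$ be a measurable space, let $\hat f:\mathcal X\to\{0,1\}$ be a fixed measurable classifier, and write $\hat y_t=\hat f(\mathbf X_t)$. For a probability law $Q$ of a pair $(\mathbf X,y)\in\mathcal X\times\{0,1\}$ let $TP=Q(\hat y=1,y=1)$, $TN=Q(\hat y=0,y=0)$, $FP=Q(\hat y=1,y=0)$, $FN=Q(\hat y=0,y=1)$, and $$P_{tpr}=\tfrac{TP}{TP+FN},\quad P_{tnr}=\tfrac{TN}{TN+FP},\quad P_{ppv}=\tfrac{TP}{TP+FP},\quad P_{npv}=\tfrac{TN}{TN+FN}.$$ Fix $\star\in\{tpr,tnr,ppv,npv\}$. Suppose that the concept is stable, i.e. the pairs $(\mathbf X_t,y_t)$, $t=1,2,\dots$, are i.i.d. with a law $Q$. A time step $t$ is relevant for $\star$ if $y_t=1$ (for $tpr$), $y_t=0$ (for $tnr$), $\hat y_t=1$ (for $ppv$), $\hat y_t=0$ (for $npv$). Let $N_\star$ be the number of relevant steps $t\le T$ and let $\hat P_\star^{(T)}$ be the fraction of correct predictions ($\hat y_t=y_t$) among them. (a) For all $1\le n\le T$, in the statistical model in which $(\mathbf X_t,y_t)_{t\le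 T}$ is observed conditionally on $N_\star=n$, where $Q$ is unknown and ranges over all laws with $\mathbb P_Q(N_\star=n)>0$, $\hat P_\star^{(T)}$ is the unique uniformly minimum variance unbiased estimator (UMVUE) of $P_\star$: it is unbiased, under every $Q$ its variance is finite and at most that of any other unbiased estimator, and any other UMVUE equals it almost surely under every $Q$. For all $T\ge1$ the same holds conditionally on $N_\star\ge1$, where $Q$ ranges over all laws with $\mathbb P_Q(N_\star\ge 1)>0$. (b) If the denominator in the definition of $P_\star$ is positive, then, as $T\to\infty$, $\hat P_\star^{(T)}$ is asymptotically $\mathcal N\bigl(P_\star,P_\star(1-P_\star)/N_\star\bigr)$, in the sense that $$\sqrt{N_\star}\,\bigl(\hat P_\star^{(T)}-P_\star\bigr)\ \longrightarrow\ \mathcal N\bigl(0,P_\star(1-P_\star)\bigr)\quad\text{in distribution},$$ where $N_\star$ is the (random) number of relevant steps up to time $T$ and a normal law of variance $0$ is a point mass. -/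

import Mathlib

open MeasureTheory ProbabilityTheory Filter

noncomputable section

/-- The four characteristic rates of a binary classifier. -/
inductive Rate
  | tpr
  | tnr
  | ppv
  | npv

/-- Numerator of a rate in a `2 × 2` confusion matrix `M` (first index: predicted label, second
index: true label; `false` is the label 0 and `true` is the label 1). -/
def Rate.hit {α : Type*} (M : Bool → Bool → α) : Rate → α
  | .tpr => M true true
  | .tnr => M false false
  | .ppv => M true true
  | .npv => M false false

/-- Denominator of a rate in a `2 × 2` confusion matrix: `TP + FN`, `TN + FP`, `TP + FP` and
`TN + FN` respectively. -/
def Rate.total {α : Type*} [Add α] (M : Bool → Bool → α) : Rate → α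
  | .tpr => M true true + M false true
  | .tnr => M false false + M true false
  | .ppv => M true true + M true false
  | .npv => M false false + M false true

/-- The confusion probability matrix of the classifier `f` when the pair (features, label)
has the law `Q`. -/
def confusionProb {𝒳 : Type*} [MeasurableSpace 𝒳] (f : 𝒳 → Bool) (Q : Measure (𝒳 × Bool))
    (i j : Bool) : ℝ :=
  Q.real {z | f z.1 = i ∧ z.2 = j}

/-- The underlying rate `P_⋆` under the concept `Q`. -/
def trueRate {𝒳 : Type*} [MeasurableSpace 𝒳] (f : 𝒳 → Bool) (r : Rate)
    (Q : Measure (𝒳 × Bool)) : ℝ :=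
  r.hit (confusionProb f Q) / r.total (confusionProb f Q)

/-- The empirical confusion matrix of the data observed during `T` time steps. -/
def confusionCount {𝒳 : Type*} (f : 𝒳 → Bool) {T : ℕ} (d : Fin T → 𝒳 × Bool) (i j : Bool) : ℕ :=
  (Finset.univ.filter fun t : Fin T => f (d t).1 = i ∧ (d t).2 = j).card

/-- `N_⋆`: the number of time steps, among the `T` observed ones, that influence the rate. -/
def relevantCount {𝒳 : Type*} (f : 𝒳 → Bool) (r : Rate) {T : ℕ} (d : Fin T → 𝒳 × Bool) : ℕ :=
  r.total (confusionCount f d)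

/-- The empirical rate: the fraction of correct predictions among the `N_⋆` relevant steps. -/
def empiricalRate {𝒳 : Type*} (f : 𝒳 → Bool) (r : Rate) {T : ℕ} (d : Fin T → 𝒳 × Bool) : ℝ :=
  ((r.hit (confusionCount f d) : ℕ) : ℝ) / (relevantCount f r d : ℝ)

/-- `δ` is an unbiased estimator of `g θ` in the statistical model `(P θ)`. -/
structure IsUnbiasedEstimator {Θ S : Type*} [MeasurableSpace S] (P : Θ → Measure S)
    (g : Θ → ℝ) (δ : S → ℝ) : Prop where
  measurable : Measurable δ
  integrable : ∀ θ, Integrable δ (P θ)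
  integral_eq : ∀ θ, ∫ s, δ s ∂(P θ) = g θ

/-- `δ` is a uniformly minimum variance unbiased estimator of `g θ` in the model `(P θ)`.
Variances take values in `[0, ∞]`. -/
structure IsUMVUE {Θ S : Type*} [MeasurableSpace S] (P : Θ → Measure S)
    (g : Θ → ℝ) (δ : S → ℝ) : Prop where
  unbiased : IsUnbiasedEstimator P g δ
  evariance_lt_top : ∀ θ, evariance δ (P θ) < ⊤
  evariance_le : ∀ δ' : S → ℝ, IsUnbiasedEstimator P g δ' →
    ∀ θ, evariance δ (P θ) ≤ evariance δ' (P θ)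

/-- `δ` is the unique UMVUE: any other one agrees with it almost surely under every parameter. -/
structure IsUniqueUMVUE {Θ S : Type*} [MeasurableSpace S] (P : Θ → Measure S)
    (g : Θ → ℝ) (δ : S → ℝ) : Prop where
  isUMVUE : IsUMVUE P g δ
  unique : ∀ δ' : S → ℝ, IsUMVUE P g δ' → ∀ θ, δ' =ᵐ[P θ] δ

/-- The law of the data up to time `T` under the stable concept `Q`: `T` independent pairs
(features, label), each with law `Q`. -/
def stableLaw {𝒳 : Type*} [MeasurableSpace 𝒳] (T : ℕ) (Q : ProbabilityMeasure (𝒳 × Bool)) :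
    Measure (Fin T → 𝒳 × Bool) :=
  Measure.pi fun _ : Fin T => (Q : Measure (𝒳 × Bool))

/-- The event that the number of relevant steps lies in `K`. -/
def countEvent {𝒳 : Type*} (f : 𝒳 → Bool) (r : Rate) (T : ℕ) (K : Set ℕ) :
    Set (Fin T → 𝒳 × Bool) :=
  {d | relevantCount f r d ∈ K}

/-- The (unknown) concepts under which the event `N_⋆ ∈ K` has positive probability. -/
abbrev StableConcept {𝒳 : Type*} [MeasurableSpace 𝒳] (f : 𝒳 → Bool) (r : Rate) (T : ℕ) (K : Set ℕ) :
    Type _ :=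
  {Q : ProbabilityMeasure (𝒳 × Bool) // stableLaw T Q (countEvent f r T K) ≠ 0}

/-- The statistical model of the data up to time `T` under a stable unknown concept,
given that the number of relevant steps lies in `K`. -/
def stableModel {𝒳 : Type*} [MeasurableSpace 𝒳] (f : 𝒳 → Bool) (r : Rate) (T : ℕ) (K : Set ℕ)
    (Q : StableConcept f r T K) : Measure (Fin T → 𝒳 × Bool) :=
  ProbabilityTheory.cond (stableLaw T Q.1) (countEvent f r T K)

end

/-! Unbiasedness. Among i.i.d. steps, the expected total of a function supported on relevant steps,
weighted by a function of `N_⋆`, is a constant times its one-step mean, and that constant is the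
same for all such functions. With weight `1 / N_⋆` on the conditioning event, successes give the
integral of the empirical rate over the event and relevant steps give the probability of the event;
the quotient is the ratio of the one-step means, which is `P_⋆`.

Optimality. By Rao's criterion it is enough that the rate is orthogonal to every unbiased estimator
`u` of zero. The class of concepts is closed under exponential tilting, so any `Q` can be reweighted
by `z ^ m`, where `m` sums integer scores of the steps and encodes both `N_⋆` and the number of
hits. Unbiasedness at all tilted laws says that a polynomial in `z` vanishes on `z > 0`. Its
coefficients, the integrals of `u` over the level sets of `m` within the event, are then zero, and
the rate is a function of `m`.

Asymptotics. The normalized error is a centered i.i.d. sum over `√T`, divided by `√(N_⋆ / T)`: the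
central limit theorem, the strong law and Slutsky's theorem apply. -/

/-- **Rao's criterion**: a square integrable unbiased estimator which is orthogonal to every
unbiased estimator of zero is the unique UMVUE. -/
theorem IsUnbiasedEstimator.isUniqueUMVUE {Θ S : Type*} [MeasurableSpace S] {P : Θ → Measure S}
    [∀ θ, IsProbabilityMeasure (P θ)] {g : Θ → ℝ} {δ : S → ℝ} (hδ : IsUnbiasedEstimator P g δ)
    (hL2 : ∀ θ, MemLp δ 2 (P θ))
    (horth : ∀ u : S → ℝ, IsUnbiasedEstimator P (fun _ => 0) u →
      ∀ θ, ∫ s, δ s * u s ∂(P θ) = 0) :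
    IsUniqueUMVUE P g δ := by
  have hzero (δ' : S → ℝ) (hδ' : IsUnbiasedEstimator P g δ') :
      IsUnbiasedEstimator P (fun _ => 0) (δ' - δ) := by
    refine ⟨hδ'.measurable.sub hδ.measurable,
      fun θ => (hδ'.integrable θ).sub (hδ.integrable θ), fun θ => ?_⟩
    simp only [Pi.sub_apply]
    rw [integral_sub (hδ'.integrable θ) (hδ.integrable θ), hδ'.integral_eq, hδ.integral_eq,
      sub_self]
  have hvar (δ' : S → ℝ) (hδ' : IsUnbiasedEstimator P g δ') (θ : Θ) (h2 : MemLp δ' 2 (P θ)) :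
      Var[δ'; P θ] = Var[δ; P θ] + Var[δ' - δ; P θ] := by
    have hu : MemLp (δ' - δ) 2 (P θ) := h2.sub (hL2 θ)
    have hcov : cov[δ, δ' - δ; P θ] = 0 := by
      rw [covariance_eq_sub (hL2 θ) hu, (hzero δ' hδ').integral_eq, mul_zero, sub_zero]
      exact horth _ (hzero δ' hδ') θ
    have := variance_add (hL2 θ) hu
    rwa [hcov, mul_zero, add_zero, add_sub_cancel] at this
  refine ⟨⟨hδ, fun θ => evariance_lt_top (hL2 θ), fun δ' hδ' θ => ?_⟩, fun δ' hδ' θ => ?_⟩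
  · by_cases h2 : MemLp δ' 2 (P θ)
    · rw [← ofReal_variance h2, ← ofReal_variance (hL2 θ), hvar δ' hδ' θ h2]
      exact ENNReal.ofReal_le_ofReal (le_add_of_nonneg_right (variance_nonneg _ _))
    · rw [evariance_eq_top hδ'.measurable.aestronglyMeasurable h2]
      exact le_top
  · have h2 : MemLp δ' 2 (P θ) :=
      (evariance_lt_top_iff_memLp hδ'.unbiased.measurable.aestronglyMeasurable).1
        (hδ'.evariance_lt_top θ)
    -- Minimality of `δ'` reverses the Pythagorean identity `hvar`, so `δ' - δ` has variance zero,
    -- and its mean is zero.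
    have hle : Var[δ'; P θ] ≤ Var[δ; P θ] :=
      ENNReal.toReal_mono (evariance_ne_top (hL2 θ)) (hδ'.evariance_le δ hδ θ)
    have hu0 : Var[δ' - δ; P θ] = 0 :=
      le_antisymm (by linarith [hvar δ' hδ'.unbiased θ h2]) (variance_nonneg _ _)
    filter_upwards [ae_eq_integral_of_variance_eq_zero (h2.sub (hL2 θ)) hu0] with s hs
    rw [(hzero δ' hδ'.unbiased).integral_eq] at hs
    exact sub_eq_zero.1 hs

/-! ### Tilting, power series and exchangeable sums -/

/-- The product of tilted probability measures is the tilted product. -/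
theorem pi_tilted {S : Type*} [MeasurableSpace S] (Q : Measure S) [IsProbabilityMeasure Q]
    (g : S → ℝ) (hg : Integrable (fun x => Real.exp (g x)) Q) (T : ℕ) :
    Measure.pi (fun _ : Fin T => Q.tilted g) =
      (Measure.pi fun _ : Fin T => Q).tilted (fun d => ∑ t, g (d t)) := by
  have := isProbabilityMeasure_tilted hg
  refine Measure.pi_eq fun s hs => ?_
  have hc : ∫ d, Real.exp (∑ t, g (d t)) ∂(Measure.pi fun _ : Fin T => Q)
      = ∏ _t : Fin T, ∫ x, Real.exp (g x) ∂Q := by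
    simp_rw [Real.exp_sum]
    exact integral_fintype_prod_eq_prod (fun _ x => Real.exp (g x))
  rw [tilted_apply_eq_ofReal_integral, hc]
  simp_rw [tilted_apply_eq_ofReal_integral, Real.exp_sum, ← Finset.prod_div_distrib]
  rw [Measure.restrict_pi_pi,
    integral_fintype_prod_eq_prod (fun _ x => Real.exp (g x) / ∫ x, Real.exp (g x) ∂Q),
    ENNReal.ofReal_prod_of_nonneg]
  exact fun t _ => integral_nonneg fun x =>
    div_nonneg (Real.exp_nonneg _) (integral_nonneg fun x => Real.exp_nonneg _)

/-- If the power series `∑ k, z ^ k * 𝔼[v; m = k]` of an integrable function `v` and a bounded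
statistic `m` vanishes for all `z > 0`, then `v` is orthogonal to all functions of `m`. -/
theorem integral_mul_comp_eq_zero_of_integral_mul_pow_eq_zero {D : Type*} [MeasurableSpace D]
    {ν : Measure D} {v : D → ℝ} (hv : Integrable v ν) {m : D → ℕ} (hm : Measurable m) {M : ℕ}
    (hM : ∀ d, m d < M) (h : ∀ z : ℝ, 0 < z → ∫ d, z ^ m d * v d ∂ν = 0) (ψ : ℕ → ℝ) :
    ∫ d, ψ (m d) * v d ∂ν = 0 := by
  have hms (k : ℕ) : MeasurableSet (m ⁻¹' {k}) := hm (measurableSet_singleton k)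
  have hexp (φ : ℕ → ℝ) : ∫ d, φ (m d) * v d ∂ν
      = ∑ k ∈ Finset.range M, φ k * ∫ d, (m ⁻¹' {k}).indicator v d ∂ν := by
    simp_rw [← integral_const_mul]
    rw [← integral_finsetSum _ fun k _ => (hv.indicator (hms k)).const_mul (φ k)]
    refine integral_congr_ae (ae_of_all _ fun d => ?_)
    simp only
    rw [Finset.sum_eq_single (m d)]
    · simp
    · intro k _ hk
      simp [Set.indicator_of_notMem (show d ∉ m ⁻¹' {k} from fun h => hk h.symm)]
    · intro hd
      exact absurd (Finset.mem_range.2 (hM d)) hd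
  let p : Polynomial ℝ :=
    ∑ k ∈ Finset.range M, Polynomial.monomial k (∫ d, (m ⁻¹' {k}).indicator v d ∂ν)
  have hp : p = 0 := by
    refine Polynomial.eq_zero_of_infinite_isRoot p ((Set.Ioi_infinite (0 : ℝ)).mono fun z hz => ?_)
    have := h z hz
    rw [hexp (fun k => z ^ k)] at this
    simpa [p, Polynomial.IsRoot, Polynomial.eval_finsetSum, mul_comm] using this
  have hcoeff (k : ℕ) (hk : k ∈ Finset.range M) : ∫ d, (m ⁻¹' {k}).indicator v d ∂ν = 0 := by
    have := congrArg (fun q => q.coeff k) hp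
    simpa [p, Polynomial.finsetSum_coeff, Polynomial.coeff_monomial, Finset.mem_range.1 hk]
      using this
  rw [hexp]
  exact Finset.sum_eq_zero fun k hk => by rw [hcoeff k hk, mul_zero]

/-- For i.i.d. data and a function `φ` of the number of occurrences of the event `ind = 1`, the
expectation of `(∑ t, g (d t)) * φ` is proportional to the expectation of `g`, among the functions
`g` which vanish outside that event. -/
theorem integral_sum_mul_comp_count {S : Type*} [MeasurableSpace S] (Q : Measure S)
    [IsProbabilityMeasure Q] {ind : S → ℕ} (hind : Measurable ind)
    (φ : ℕ → ℝ) (T : ℕ) :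
    ∃ c : ℝ, ∀ g : S → ℝ, Measurable g → (∀ x, 0 ≤ g x ∧ g x ≤ 1) →
      (∀ x, ind x ≤ 1) → (∀ x, ind x ≠ 1 → g x = 0) →
      ∫ d, (∑ t, g (d t)) * φ (∑ t, ind (d t)) ∂(Measure.pi fun _ : Fin T => Q)
        = c * ∫ x, g x ∂Q := by
  cases T with
  | zero => exact ⟨0, fun g _ _ _ _ => by simp⟩
  | succ T =>
    -- Each of the `T + 1` steps contributes equally. Where `g (d t) ≠ 0`, step `t` adds exactly 1
    -- to the count, and the remaining `T` steps are independent of it.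
    refine ⟨(T + 1) * ∫ d, φ (1 + ∑ t, ind (d t)) ∂(Measure.pi fun _ : Fin T => Q),
      fun g hg hg01 hind1 hsupp => ?_⟩
    have hNm (T : ℕ) : Measurable fun d : Fin T → S => ∑ t, ind (d t) :=
      Finset.measurable_sum _ fun t _ => hind.comp (measurable_pi_apply t)
    have hφm (T : ℕ) : Measurable fun d : Fin T → S => φ (∑ t, ind (d t)) :=
      (measurable_of_countable φ).comp (hNm T)
    have hbound (d : Fin (T + 1) → S) : |φ (∑ t, ind (d t))|
        ≤ ∑ k ∈ Finset.range (T + 2), |φ k| := by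
      refine Finset.single_le_sum (f := fun k => |φ k|) (fun _ _ => abs_nonneg _) ?_
      rw [Finset.mem_range]
      have : ∑ t, ind (d t) ≤ ∑ _t : Fin (T + 1), 1 := Finset.sum_le_sum fun t _ => hind1 _
      simp at this
      omega
    have hint (t : Fin (T + 1)) : Integrable (fun d => g (d t) * φ (∑ t, ind (d t)))
        (Measure.pi fun _ : Fin (T + 1) => Q) := by
      refine Integrable.of_bound (C := ∑ k ∈ Finset.range (T + 2), |φ k|) ?_ (ae_of_all _ fun d => ?_)
      · exact ((hg.comp (measurable_pi_apply t)).mul (hφm _)).aestronglyMeasurable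
      · rw [Real.norm_eq_abs, abs_mul, abs_of_nonneg (hg01 _).1]
        exact (mul_le_of_le_one_left (abs_nonneg _) (hg01 _).2).trans (hbound d)
    have hone (t : Fin (T + 1)) :
        ∫ d, g (d t) * φ (∑ t, ind (d t)) ∂(Measure.pi fun _ : Fin (T + 1) => Q)
          = (∫ x, g x ∂Q) *
            ∫ d, φ (1 + ∑ t, ind (d t)) ∂(Measure.pi fun _ : Fin T => Q) := by
      rw [← integral_prod_mul, ← (measurePreserving_piFinSuccAbove
        (fun _ : Fin (T + 1) => Q) t).integral_comp']
      refine integral_congr_ae (ae_of_all _ fun d => ?_)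
      simp only [MeasurableEquiv.piFinSuccAbove_apply, Fin.insertNthEquiv_symm_apply]
      by_cases h : ind (d t) = 1
      · rw [Fin.sum_univ_succAbove _ t, h]
        rfl
      · simp [hsupp _ h]
    simp_rw [Finset.sum_mul]
    rw [integral_finsetSum _ fun t _ => hint t]
    simp_rw [hone]
    simp
    ring

/-! ### Confusion matrices through indicators of relevance and success -/

/-- `1` if a step with predicted label `i` and true label `j` is relevant for the rate, else `0`. -/
def Rate.relevance (i j : Bool) : Rate → ℕ
  | .tpr => j.toNat
  | .tnr => (!j).toNat
  | .ppv => i.toNat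
  | .npv => (!i).toNat

/-- `1` if a step with predicted label `i` and true label `j` is relevant for the rate and correctly
predicted, else `0`. -/
def Rate.success (i j : Bool) : Rate → ℕ
  | .tpr | .ppv => (i && j).toNat
  | .tnr | .npv => (!i && !j).toNat

theorem Rate.relevance_le_one (i j : Bool) (r : Rate) : r.relevance i j ≤ 1 := by
  cases r <;> cases i <;> cases j <;> decide

theorem Rate.success_le_relevance (i j : Bool) (r : Rate) : r.success i j ≤ r.relevance i j := by
  cases r <;> cases i <;> cases j <;> decide

theorem Rate.success_mul_relevance (i j : Bool) (r : Rate) :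
    r.success i j * r.relevance i j = r.success i j := by
  cases r <;> cases i <;> cases j <;> decide

theorem Rate.success_mul_self (i j : Bool) (r : Rate) :
    r.success i j * r.success i j = r.success i j := by
  cases r <;> cases i <;> cases j <;> decide

theorem Rate.relevance_mul_self (i j : Bool) (r : Rate) :
    r.relevance i j * r.relevance i j = r.relevance i j := by
  cases r <;> cases i <;> cases j <;> decide

section

variable {𝒳 : Type*} (f : 𝒳 → Bool) (r : Rate)

theorem hit_confusionCount {T : ℕ} (d : Fin T → 𝒳 × Bool) :
    r.hit (confusionCount f d) = ∑ t, r.success (f (d t).1) (d t).2 := by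
  cases r <;> simp only [Rate.hit, confusionCount, Finset.card_filter] <;>
    refine Finset.sum_congr rfl fun t _ => ?_ <;>
    cases f (d t).1 <;> cases (d t).2 <;> rfl

theorem relevantCount_eq_sum {T : ℕ} (d : Fin T → 𝒳 × Bool) :
    relevantCount f r d = ∑ t, r.relevance (f (d t).1) (d t).2 := by
  cases r <;> simp only [relevantCount, Rate.total, confusionCount, Finset.card_filter,
    ← Finset.sum_add_distrib] <;>
    refine Finset.sum_congr rfl fun t _ => ?_ <;>
    cases f (d t).1 <;> cases (d t).2 <;> rfl

theorem relevantCount_le {T : ℕ} (d : Fin T → 𝒳 × Bool) : relevantCount f r d ≤ T := by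
  rw [relevantCount_eq_sum]
  simpa using Finset.sum_le_sum fun t (_ : t ∈ Finset.univ) =>
    r.relevance_le_one (f (d t).1) (d t).2

theorem hit_le_relevantCount {T : ℕ} (d : Fin T → 𝒳 × Bool) :
    r.hit (confusionCount f d) ≤ relevantCount f r d := by
  rw [hit_confusionCount, relevantCount_eq_sum]
  exact Finset.sum_le_sum fun t _ => r.success_le_relevance _ _

theorem empiricalRate_mem_Icc {T : ℕ} (d : Fin T → 𝒳 × Bool) :
    empiricalRate f r d ∈ Set.Icc (0 : ℝ) 1 :=
  ⟨by unfold empiricalRate; positivity,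
    div_le_one_of_le₀ (by exact_mod_cast hit_le_relevantCount f r d) (Nat.cast_nonneg _)⟩

variable [MeasurableSpace 𝒳] {f} (hf : Measurable f)
include hf

theorem measurable_comp_labels {β : Type*} [MeasurableSpace β] (w : Bool → Bool → β) :
    Measurable fun x : 𝒳 × Bool => w (f x.1) x.2 :=
  (measurable_of_countable fun p : Bool × Bool => w p.1 p.2).comp
    ((hf.comp measurable_fst).prodMk measurable_snd)

theorem integrable_comp_labels (Q : Measure (𝒳 × Bool)) [IsFiniteMeasure Q]
    (w : Bool → Bool → ℝ) : Integrable (fun x => w (f x.1) x.2) Q := by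
  refine Integrable.of_bound (C := |w true true| + |w true false| + |w false true|
    + |w false false|) (measurable_comp_labels hf w).aestronglyMeasurable (ae_of_all _ fun x => ?_)
  rw [Real.norm_eq_abs]
  have h (i j : Bool) := abs_nonneg (w i j)
  cases f x.1 <;> cases x.2 <;>
    linarith [h true true, h true false, h false true, h false false]

theorem confusionProb_eq_integral (Q : Measure (𝒳 × Bool)) (i j : Bool) :
    confusionProb f Q i j = ∫ x, (if f x.1 = i ∧ x.2 = j then 1 else 0 : ℝ) ∂Q := by
  have hs : MeasurableSet {x : 𝒳 × Bool | f x.1 = i ∧ x.2 = j} :=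
    ((hf.comp measurable_fst) (measurableSet_singleton i)).inter
      (measurable_snd (measurableSet_singleton j))
  rw [confusionProb, ← integral_indicator_one hs]
  simp only [Set.indicator_apply, Set.mem_ofPred_eq, Pi.one_apply]

theorem hit_confusionProb (Q : Measure (𝒳 × Bool)) :
    r.hit (confusionProb f Q) = ∫ x, (r.success (f x.1) x.2 : ℝ) ∂Q := by
  cases r <;> simp only [Rate.hit, confusionProb_eq_integral hf] <;>
    refine integral_congr_ae (ae_of_all _ fun x => ?_) <;>
    rcases x with ⟨x, _ | _⟩ <;> cases h : f x <;> simp [Rate.success, h]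

theorem total_confusionProb (Q : Measure (𝒳 × Bool)) [IsFiniteMeasure Q] :
    r.total (confusionProb f Q) = ∫ x, (r.relevance (f x.1) x.2 : ℝ) ∂Q := by
  have hi (i j : Bool) :=
    integrable_comp_labels hf Q fun i' j' => if i' = i ∧ j' = j then (1 : ℝ) else 0
  cases r <;> simp only [Rate.total, confusionProb_eq_integral hf] <;>
    rw [← integral_add (hi _ _) (hi _ _)] <;>
    refine integral_congr_ae (ae_of_all _ fun x => ?_) <;>
    rcases x with ⟨x, _ | _⟩ <;> cases h : f x <;> simp [Rate.relevance, h]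

theorem measurable_relevantCount (T : ℕ) :
    Measurable fun d : Fin T → 𝒳 × Bool => relevantCount f r d := by
  simp_rw [relevantCount_eq_sum]
  exact Finset.measurable_sum _ fun t _ =>
    (measurable_comp_labels hf fun i j => r.relevance i j).comp (measurable_pi_apply t)

theorem measurable_hit_confusionCount (T : ℕ) :
    Measurable fun d : Fin T → 𝒳 × Bool => r.hit (confusionCount f d) := by
  simp_rw [hit_confusionCount]
  exact Finset.measurable_sum _ fun t _ =>
    (measurable_comp_labels hf fun i j => r.success i j).comp (measurable_pi_apply t)

theorem measurable_empiricalRate (T : ℕ) :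
    Measurable fun d : Fin T → 𝒳 × Bool => empiricalRate f r d :=
  ((measurable_of_countable (fun n : ℕ => (n : ℝ))).comp (measurable_hit_confusionCount r hf T)).div
    ((measurable_of_countable (fun n : ℕ => (n : ℝ))).comp (measurable_relevantCount r hf T))

theorem measurableSet_countEvent (T : ℕ) (K : Set ℕ) : MeasurableSet (countEvent f r T K) :=
  measurable_relevantCount r hf T (.of_discrete)

end

/-! ### Optimality in the conditional models -/

theorem integral_cond {Ω : Type*} [MeasurableSpace Ω] (μ : Measure Ω) (s : Set Ω) (u : Ω → ℝ) :
    ∫ x, u x ∂(ProbabilityTheory.cond μ s) = (μ s).toReal⁻¹ * ∫ x in s, u x ∂μ := by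
  rw [ProbabilityTheory.cond, integral_smul_measure, ENNReal.toReal_inv, smul_eq_mul]

instance {𝒳 : Type*} [MeasurableSpace 𝒳] (T : ℕ) (Q : ProbabilityMeasure (𝒳 × Bool)) :
    IsProbabilityMeasure (stableLaw T Q) := by
  unfold stableLaw
  infer_instance

instance {𝒳 : Type*} [MeasurableSpace 𝒳] (f : 𝒳 → Bool) (r : Rate) (T : ℕ) (K : Set ℕ)
    (Q : StableConcept f r T K) : IsProbabilityMeasure (stableModel f r T K Q) :=
  cond_isProbabilityMeasure Q.2

section

variable {𝒳 : Type*} [MeasurableSpace 𝒳] {f : 𝒳 → Bool} (hf : Measurable f) (r : Rate)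
include hf

/-- The empirical rate is unbiased, conditionally on an event which forces a relevant step. -/
theorem isUnbiasedEstimator_empiricalRate (T : ℕ) {K : Set ℕ} (hK : 0 ∉ K) :
    IsUnbiasedEstimator (stableModel f r T K)
      (fun Q => trueRate f r (Q.1 : Measure (𝒳 × Bool))) (empiricalRate f r) := by
  classical
  refine ⟨measurable_empiricalRate r hf T, fun Q => ?_, fun Q => ?_⟩
  · refine Integrable.of_bound (C := 1) (measurable_empiricalRate r hf T).aestronglyMeasurable
      (ae_of_all _ fun d => ?_)
    rw [Real.norm_eq_abs, abs_of_nonneg (empiricalRate_mem_Icc f r d).1]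
    exact (empiricalRate_mem_Icc f r d).2
  · have hE := measurableSet_countEvent r hf T K
    -- One `c` serves both relevance and success, so it cancels in the quotient.
    obtain ⟨c, hc⟩ := integral_sum_mul_comp_count (Q.1 : Measure (𝒳 × Bool))
      (measurable_comp_labels hf fun i j => r.relevance i j)
      (fun n => if n ∈ K then (n : ℝ)⁻¹ else 0) T
    have hrel := hc (fun x => (r.relevance (f x.1) x.2 : ℝ))
      (measurable_comp_labels hf fun i j => (r.relevance i j : ℝ))
      (fun x => ⟨Nat.cast_nonneg _, by exact_mod_cast r.relevance_le_one _ _⟩)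
      (fun x => r.relevance_le_one _ _)
      (fun x hx => by
        have := r.relevance_le_one (f x.1) x.2
        exact_mod_cast (show r.relevance (f x.1) x.2 = 0 by omega))
    have hsuc := hc (fun x => (r.success (f x.1) x.2 : ℝ))
      (measurable_comp_labels hf fun i j => (r.success i j : ℝ))
      (fun x => ⟨Nat.cast_nonneg _, by
        exact_mod_cast (r.success_le_relevance _ _).trans (r.relevance_le_one _ _)⟩)
      (fun x => r.relevance_le_one _ _)
      (fun x hx => by
        have := r.relevance_le_one (f x.1) x.2
        have := r.success_le_relevance (f x.1) x.2
        exact_mod_cast (show r.success (f x.1) x.2 = 0 by omega))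
    have hN : ∫ d, (∑ t, (r.relevance (f (d t).1) (d t).2 : ℝ)) *
        (if ∑ t, r.relevance (f (d t).1) (d t).2 ∈ K then
          ((∑ t, r.relevance (f (d t).1) (d t).2 : ℕ) : ℝ)⁻¹ else 0) ∂(stableLaw T Q.1)
        = (stableLaw T Q.1 (countEvent f r T K)).toReal := by
      rw [← Measure.real, ← integral_indicator_one hE]
      refine integral_congr_ae (ae_of_all _ fun d => ?_)
      simp only [← Nat.cast_sum, ← relevantCount_eq_sum]
      by_cases hd : relevantCount f r d ∈ K
      · rw [if_pos hd, Set.indicator_of_mem (show d ∈ countEvent f r T K from hd), Pi.one_apply]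
        exact mul_inv_cancel₀ (Nat.cast_ne_zero.2 fun h0 => hK (h0 ▸ hd))
      · rw [if_neg hd, Set.indicator_of_notMem (show d ∉ countEvent f r T K from hd), mul_zero]
    have hH : ∫ d, (∑ t, (r.success (f (d t).1) (d t).2 : ℝ)) *
        (if ∑ t, r.relevance (f (d t).1) (d t).2 ∈ K then
          ((∑ t, r.relevance (f (d t).1) (d t).2 : ℕ) : ℝ)⁻¹ else 0) ∂(stableLaw T Q.1)
        = ∫ d in countEvent f r T K, empiricalRate f r d ∂(stableLaw T Q.1) := by
      rw [← integral_indicator hE]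
      refine integral_congr_ae (ae_of_all _ fun d => ?_)
      simp only [← Nat.cast_sum, ← relevantCount_eq_sum, ← hit_confusionCount]
      by_cases hd : relevantCount f r d ∈ K
      · rw [if_pos hd, Set.indicator_of_mem (show d ∈ countEvent f r T K from hd)]
        rfl
      · rw [if_neg hd, Set.indicator_of_notMem (show d ∉ countEvent f r T K from hd), mul_zero]
    have hpos : (stableLaw T Q.1 (countEvent f r T K)).toReal ≠ 0 :=
      (ENNReal.toReal_pos Q.2 (measure_ne_top _ _)).ne'
    rw [stableLaw] at hN hH hpos
    rw [stableModel, integral_cond, stableLaw, ← hH, hsuc, ← hN, hrel, trueRate,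
      hit_confusionProb r hf, total_confusionProb r hf]
    -- Positive probability of the event makes both `c` and the denominator of `P_⋆` nonzero.
    rw [← hN, hrel] at hpos
    have := left_ne_zero_of_mul hpos
    have := right_ne_zero_of_mul hpos
    field_simp

/-- Under every concept, the empirical rate is orthogonal to every unbiased estimator of zero. -/
theorem integral_empiricalRate_mul_eq_zero (T : ℕ) (K : Set ℕ) {u : (Fin T → 𝒳 × Bool) → ℝ}
    (hu : IsUnbiasedEstimator (stableModel f r T K) (fun _ => 0) u) (Q : StableConcept f r T K) :
    ∫ d, empiricalRate f r d * u d ∂(stableModel f r T K Q) = 0 := by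
  have hE := measurableSet_countEvent r hf T K
  -- Hits never exceed `T`, so in base `T + 1` the total code has digits `N_⋆` and hits; a single
  -- tilting parameter then separates both counts.
  let code : 𝒳 × Bool → ℕ := fun x =>
    (T + 1) * r.relevance (f x.1) x.2 + r.success (f x.1) x.2
  have hcode (d : Fin T → 𝒳 × Bool) :
      ∑ t, code (d t) = (T + 1) * relevantCount f r d + r.hit (confusionCount f d) := by
    rw [relevantCount_eq_sum, hit_confusionCount, Finset.mul_sum, ← Finset.sum_add_distrib]
  have hlt (d : Fin T → 𝒳 × Bool) : r.hit (confusionCount f d) < T + 1 :=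
    Nat.lt_succ_of_le ((hit_le_relevantCount f r d).trans (relevantCount_le f r d))
  have hint : Integrable ((countEvent f r T K).indicator u) (stableLaw T Q.1) := by
    have := hu.integrable Q
    rw [stableModel, ProbabilityTheory.cond,
      integrable_smul_measure (ENNReal.inv_ne_zero.2 (measure_ne_top _ _))
        (ENNReal.inv_ne_top.2 Q.2)] at this
    exact (integrable_indicator_iff hE).2 this
  have htilt (z : ℝ) (hz : 0 < z) :
      ∫ d, z ^ (∑ t, code (d t)) * (countEvent f r T K).indicator u d ∂(stableLaw T Q.1) = 0 := by
    have hg : Integrable (fun x => Real.exp (Real.log z * code x)) (Q.1 : Measure (𝒳 × Bool)) :=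
      integrable_comp_labels hf _ fun i j =>
        Real.exp (Real.log z * ((T + 1) * r.relevance i j + r.success i j : ℕ))
    have hQz := isProbabilityMeasure_tilted hg
    let Qz : ProbabilityMeasure (𝒳 × Bool) := ⟨_, hQz⟩
    have hlaw : stableLaw T Qz
        = (stableLaw T Q.1).tilted fun d => ∑ t, Real.log z * code (d t) :=
      pi_tilted (Q.1 : Measure (𝒳 × Bool)) _ hg T
    have hexp (d : Fin T → 𝒳 × Bool) :
        Real.exp (∑ t, Real.log z * code (d t)) = z ^ (∑ t, code (d t)) := by
      rw [← Finset.mul_sum, ← Nat.cast_sum, mul_comm, Real.exp_nat_mul, Real.exp_log hz]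
    have hgT : Integrable (fun d => Real.exp (∑ t, Real.log z * code (d t)))
        (stableLaw T Q.1) := by
      simp_rw [Real.exp_sum]
      exact Integrable.fintype_prod (f := fun _ x => Real.exp (Real.log z * code x)) fun _ => hg
    -- The tilted concept stays in the model: the original law is absolutely continuous with respect
    -- to the tilted one.
    have hQz0 : stableLaw T Qz (countEvent f r T K) ≠ 0 := fun h0 =>
      Q.2 (absolutelyContinuous_tilted hgT (hlaw ▸ h0))
    have h0 := hu.integral_eq ⟨Qz, hQz0⟩
    rw [stableModel, integral_cond, ← integral_indicator hE] at h0
    have h1 := (mul_eq_zero.1 h0).resolve_left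
      (inv_ne_zero (ENNReal.toReal_pos hQz0 (measure_ne_top _ _)).ne')
    rw [hlaw, integral_tilted] at h1
    simp_rw [hexp, smul_eq_mul, div_mul_eq_mul_div] at h1
    rw [integral_div] at h1
    refine (div_eq_zero_iff.1 h1).resolve_right ?_
    have := integral_exp_pos hgT
    simp_rw [hexp] at this
    exact this.ne'
  have hm : Measurable fun d : Fin T → 𝒳 × Bool => ∑ t, code (d t) :=
    Finset.measurable_sum _ fun t _ => (measurable_comp_labels hf fun i j =>
      (T + 1) * r.relevance i j + r.success i j).comp (measurable_pi_apply t)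
  have hM (d : Fin T → 𝒳 × Bool) : ∑ t, code (d t) < (T + 1) * (T + 1) := by
    rw [hcode]
    nlinarith [hlt d, relevantCount_le f r d]
  have key := integral_mul_comp_eq_zero_of_integral_mul_pow_eq_zero hint hm hM htilt
    fun m => ((m % (T + 1) : ℕ) : ℝ) / ((m / (T + 1) : ℕ) : ℝ)
  rw [stableModel, integral_cond, ← integral_indicator hE]
  refine mul_eq_zero_of_right _ (Eq.trans (integral_congr_ae (ae_of_all _ fun d => ?_)) key)
  simp only [hcode, Set.indicator_mul_right]
  rw [Nat.mul_add_mod, Nat.mod_eq_of_lt (hlt d), Nat.mul_add_div (Nat.succ_pos T),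
    Nat.div_eq_of_lt (hlt d), add_zero]
  rfl

theorem isUniqueUMVUE_empiricalRate (T : ℕ) {K : Set ℕ} (hK : 0 ∉ K) :
    IsUniqueUMVUE (stableModel f r T K)
      (fun Q => trueRate f r (Q.1 : Measure (𝒳 × Bool))) (empiricalRate f r) :=
  (isUnbiasedEstimator_empiricalRate hf r T hK).isUniqueUMVUE
    (fun Q => MemLp.of_bound (measurable_empiricalRate r hf T).aestronglyMeasurable 1
      (ae_of_all _ fun d => by
        rw [Real.norm_eq_abs, abs_of_nonneg (empiricalRate_mem_Icc f r d).1]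
        exact (empiricalRate_mem_Icc f r d).2))
    fun _ hu Q => integral_empiricalRate_mul_eq_zero hf r T K hu Q

end

/-! ### Asymptotic normality -/

section

variable {𝒳 : Type*} [MeasurableSpace 𝒳] {f : 𝒳 → Bool} (hf : Measurable f) (r : Rate)
  {Ω : Type*} [MeasurableSpace Ω] (μ : Measure Ω) [IsProbabilityMeasure μ]
  (X : ℕ → Ω → 𝒳) (y : ℕ → Ω → Bool) (Q : Measure (𝒳 × Bool))
include hf

theorem trueRate_mem_Icc [IsFiniteMeasure Q] : trueRate f r Q ∈ Set.Icc (0 : ℝ) 1 := by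
  rw [trueRate, hit_confusionProb r hf, total_confusionProb r hf]
  have h0 : 0 ≤ ∫ x, (r.relevance (f x.1) x.2 : ℝ) ∂Q :=
    integral_nonneg fun x => Nat.cast_nonneg _
  refine ⟨div_nonneg (integral_nonneg fun x => Nat.cast_nonneg _) h0, div_le_one_of_le₀ ?_ h0⟩
  exact integral_mono (integrable_comp_labels hf Q fun i j => (r.success i j : ℝ))
    (integrable_comp_labels hf Q fun i j => (r.relevance i j : ℝ))
    fun x => Nat.cast_le.2 (r.success_le_relevance _ _)

theorem tendstoInDistribution_empiricalRate
    (hindep : iIndepFun (fun t ω => (X t ω, y t ω)) μ)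
    (hlaw : ∀ t, HasLaw (fun ω => (X t ω, y t ω)) Q μ)
    (hpos : 0 < r.total (confusionProb f Q)) :
    TendstoInDistribution
      (fun (T : ℕ) (ω : Ω) =>
        √(relevantCount f r (fun t : Fin T => (X t ω, y t ω)) : ℝ) *
          (empiricalRate f r (fun t : Fin T => (X t ω, y t ω)) - trueRate f r Q))
      atTop (id : ℝ → ℝ) (fun _ => μ)
      (gaussianReal 0 (trueRate f r Q * (1 - trueRate f r Q)).toNNReal) := by
  have hQ : IsProbabilityMeasure Q := (hlaw 0).isProbabilityMeasure_iff.1 inferInstance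
  set P := trueRate f r Q with hP
  set q := r.total (confusionProb f Q) with hq
  have hq' : ∫ x, (r.relevance (f x.1) x.2 : ℝ) ∂Q = q := (total_confusionProb r hf Q).symm
  have hh' : ∫ x, (r.success (f x.1) x.2 : ℝ) ∂Q = P * q := by
    rw [← hit_confusionProb r hf, hP, trueRate, div_mul_cancel₀ _ hpos.ne']
  have hP01 : P ∈ Set.Icc (0 : ℝ) 1 := trueRate_mem_Icc hf r Q
  have hident (w : Bool → Bool → ℝ) (t : ℕ) :
      IdentDistrib (fun ω => w (f (X t ω)) (y t ω)) (fun ω => w (f (X 0 ω)) (y 0 ω)) μ μ :=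
    ((hlaw t).identDistrib (hlaw 0)).comp (measurable_comp_labels hf w)
  have hind (w : Bool → Bool → ℝ) : iIndepFun (fun t ω => w (f (X t ω)) (y t ω)) μ :=
    hindep.comp (fun _ x => w (f x.1) x.2) fun _ => measurable_comp_labels hf w
  have hmean (w : Bool → Bool → ℝ) :
      ∫ ω, w (f (X 0 ω)) (y 0 ω) ∂μ = ∫ x, w (f x.1) x.2 ∂Q :=
    (hlaw 0).integral_comp (f := fun x => w (f x.1) x.2)
      (measurable_comp_labels hf w).aestronglyMeasurable
  let rel : Bool → Bool → ℝ := fun i j => r.relevance i j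
  -- These residuals sum to `N_⋆` times the estimation error when `N_⋆ > 0`; they have mean `P * q -
  -- P * q = 0`.
  let res : Bool → Bool → ℝ := fun i j => r.success i j - P * r.relevance i j
  have hiS := integrable_comp_labels hf Q fun i j => (r.success i j : ℝ)
  have hiR := integrable_comp_labels hf Q fun i j => (r.relevance i j : ℝ)
  have hres0 : ∫ ω, res (f (X 0 ω)) (y 0 ω) ∂μ = 0 := by
    rw [hmean]
    simp only [res]
    rw [integral_sub hiS (hiR.const_mul P), integral_const_mul, hh', hq', sub_self]
  have hresm : Measurable fun x : 𝒳 × Bool => res (f x.1) x.2 := measurable_comp_labels hf res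
  have hL2 : MemLp (fun ω => res (f (X 0 ω)) (y 0 ω)) 2 μ := by
    refine MemLp.of_bound (hresm.comp_aemeasurable (hlaw 0).aemeasurable).aestronglyMeasurable
      (|res true true| + |res true false| + |res false true| + |res false false|)
      (ae_of_all _ fun ω => ?_)
    rw [Real.norm_eq_abs]
    have h (i j : Bool) := abs_nonneg (res i j)
    cases f (X 0 ω) <;> cases y 0 ω <;>
      linarith [h true true, h true false, h false true, h false false]
  have hvar : Var[fun ω => res (f (X 0 ω)) (y 0 ω); μ] = q * (P * (1 - P)) := by
    rw [variance_of_integral_eq_zero hL2.aemeasurable hres0,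
      hmean fun i j => res i j ^ 2]
    have hsq (x : 𝒳 × Bool) : res (f x.1) x.2 ^ 2
        = (1 - 2 * P) * r.success (f x.1) x.2 + P ^ 2 * r.relevance (f x.1) x.2 := by
      have h1 : (r.success (f x.1) x.2 : ℝ) * r.relevance (f x.1) x.2 = r.success (f x.1) x.2 := by
        exact_mod_cast r.success_mul_relevance _ _
      have h2 : (r.success (f x.1) x.2 : ℝ) * r.success (f x.1) x.2 = r.success (f x.1) x.2 := by
        exact_mod_cast r.success_mul_self _ _
      have h3 : (r.relevance (f x.1) x.2 : ℝ) * r.relevance (f x.1) x.2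
          = r.relevance (f x.1) x.2 := by
        exact_mod_cast r.relevance_mul_self _ _
      simp only [res]
      linear_combination h2 - 2 * P * h1 + P ^ 2 * h3
    simp_rw [hsq]
    rw [integral_add (hiS.const_mul _) (hiR.const_mul _), integral_const_mul, integral_const_mul,
      hh', hq']
    ring
  -- The limit of the sum is realized as `√q * x` with `x` of the target law, so that division by
  -- `√q` in Slutsky's theorem leaves the identity.
  have hY : HasLaw (fun x : ℝ => √q * x)
      (gaussianReal 0 Var[fun ω => res (f (X 0 ω)) (y 0 ω); μ].toNNReal)
      (gaussianReal 0 (P * (1 - P)).toNNReal) := by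
    have := gaussianReal_const_mul
      (HasLaw.id (μ := gaussianReal 0 (P * (1 - P)).toNNReal)) (√q)
    rw [mul_zero] at this
    convert! this using 2
    rw [hvar]
    ext
    rw [Real.coe_toNNReal _ (mul_nonneg hpos.le (mul_nonneg hP01.1 (sub_nonneg.2 hP01.2)))]
    simp [Real.sq_sqrt hpos.le, Real.coe_toNNReal _ (mul_nonneg hP01.1 (sub_nonneg.2 hP01.2))]
  have hclt := tendstoInDistribution_inv_sqrt_mul_sum_sub
    (X := fun t ω => res (f (X t ω)) (y t ω)) hY hL2 (hind res) (hident res)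
  have hrelint : Integrable (fun ω => rel (f (X 0 ω)) (y 0 ω)) μ :=
    (((hlaw 0).identDistrib HasLaw.id).comp (measurable_comp_labels hf rel)).integrable_iff.2 hiR
  have hratiom (T : ℕ) : AEMeasurable
      (fun ω => (√((∑ t ∈ Finset.range T, rel (f (X t ω)) (y t ω)) / T))⁻¹) μ :=
    (((Finset.aemeasurable_fun_sum _ fun t _ => (hident rel t).aemeasurable_fst).div_const
      _).sqrt).inv
  have hslln := strong_law_ae_real (fun t ω => rel (f (X t ω)) (y t ω)) hrelint
    (fun i j hij => (hind rel).indepFun hij) (hident rel)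
  have hratio : TendstoInMeasure μ
      (fun (T : ℕ) ω => (√((∑ t ∈ Finset.range T, rel (f (X t ω)) (y t ω)) / T))⁻¹) atTop
      (fun _ => (√q)⁻¹) := by
    refine tendstoInMeasure_of_tendsto_ae (fun T => (hratiom T).aestronglyMeasurable) ?_
    filter_upwards [hslln] with ω hω
    rw [hmean rel, hq'] at hω
    exact ((Real.continuous_sqrt.tendsto q).comp hω).inv₀ (Real.sqrt_pos.2 hpos).ne'
  have hslutsky := hclt.continuous_comp_prodMk_of_tendstoInMeasure_const
    (g := fun p : ℝ × ℝ => p.1 * p.2) (by fun_prop) hratio hratiom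
  refine hslutsky.congr (fun T => ae_of_all _ fun ω => ?_) (ae_of_all _ fun x => ?_)
  · simp only
    have hH : ((r.hit (confusionCount f fun t : Fin T => (X t ω, y t ω)) : ℕ) : ℝ)
        = ∑ t ∈ Finset.range T, (r.success (f (X t ω)) (y t ω) : ℝ) := by
      rw [hit_confusionCount, Nat.cast_sum, Finset.sum_range]
    have hN : (relevantCount f r (fun t : Fin T => (X t ω, y t ω)) : ℝ)
        = ∑ t ∈ Finset.range T, rel (f (X t ω)) (y t ω) := by
      rw [relevantCount_eq_sum, Nat.cast_sum, Finset.sum_range]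
    have hsum : ∑ t ∈ Finset.range T, res (f (X t ω)) (y t ω)
        = r.hit (confusionCount f fun t : Fin T => (X t ω, y t ω))
          - P * relevantCount f r (fun t : Fin T => (X t ω, y t ω)) := by
      rw [hH, hN, Finset.mul_sum, ← Finset.sum_sub_distrib]
    have hNT : (relevantCount f r (fun t : Fin T => (X t ω, y t ω)) : ℝ) ≤ T := by
      exact_mod_cast relevantCount_le f r _
    rw [hsum, hres0, ← hN, empiricalRate, mul_zero, sub_zero, Real.sqrt_div (Nat.cast_nonneg _)]
    -- If `N_⋆ = 0`, both sides vanish by `√0 = 0` and `0⁻¹ = 0`.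
    rcases (Nat.cast_nonneg (α := ℝ)
      (relevantCount f r fun t : Fin T => (X t ω, y t ω))).eq_or_lt with h0 | h0
    · simp [← h0]
    · generalize (relevantCount f r fun t : Fin T => (X t ω, y t ω) : ℝ) = N at *
      have hs := Real.sq_sqrt h0.le
      have := Real.sqrt_pos.2 h0
      have := Real.sqrt_pos.2 (h0.trans_le hNT)
      field_simp
      rw [hs]
      ring
  · have := Real.sqrt_pos.2 hpos
    simp only [id]
    field_simp

end

theorem lemma1 {𝒳 : Type*} [MeasurableSpace 𝒳] (f : 𝒳 → Bool) (hf : Measurable f) (r : Rate) :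
    -- given that there are exactly `n` relevant steps
    (∀ T n : ℕ, 1 ≤ n → n ≤ T →
      IsUniqueUMVUE (stableModel f r T {n})
        (fun Q => trueRate f r (Q.1 : Measure (𝒳 × Bool))) (empiricalRate f r)) ∧
    -- given only that there is at least one relevant step
    (∀ T : ℕ, 1 ≤ T →
      IsUniqueUMVUE (stableModel f r T (Set.Ici 1))
        (fun Q => trueRate f r (Q.1 : Measure (𝒳 × Bool))) (empiricalRate f r)) ∧
    -- asymptotic normality
    (∀ {Ω : Type*} [MeasurableSpace Ω] (μ : Measure Ω) [IsProbabilityMeasure μ]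
      (X : ℕ → Ω → 𝒳) (y : ℕ → Ω → Bool) (Q : Measure (𝒳 × Bool)),
      iIndepFun (fun t ω => (X t ω, y t ω)) μ →
      (∀ t, HasLaw (fun ω => (X t ω, y t ω)) Q μ) →
      0 < r.total (confusionProb f Q) →
      TendstoInDistribution
        (fun (T : ℕ) (ω : Ω) =>
          √(relevantCount f r (fun t : Fin T => (X t ω, y t ω)) : ℝ) *
            (empiricalRate f r (fun t : Fin T => (X t ω, y t ω)) - trueRate f r Q))
        atTop (id : ℝ → ℝ) (fun _ => μ)
        (gaussianReal 0 (trueRate f r Q * (1 - trueRate f r Q)).toNNReal)) := by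
  refine ⟨fun T n hn _ => isUniqueUMVUE_empiricalRate hf r T ?_,
    fun T _ => isUniqueUMVUE_empiricalRate hf r T ?_,
    fun μ _ X y Q hindep hlaw hpos =>
      tendstoInDistribution_empiricalRate hf r μ X y Q hindep hlaw hpos⟩
  · exact fun h => absurd (Set.mem_singleton_iff.1 h) (by omega)
  · simp
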